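/- Let $\mathbb{K}$ be a field and let $V$ be a vector space over $\mathbb{K}$ of finite positive dimension. A tridiagonal pair on $V$ is an ordered pair $A,A^*$ of diagonalizable $\mathbb{K}$-linear maps $V\to V$ such that (a) the eigenspaces of $A$ have an ordering $\{V_i\}_{i=0}^{d}$ with $A^*V_i\subseteq V_{i-1}+V_i+V_{i+1}$ for $0\le i\le d$, where $V_{-1}=V_{d+1}=0$; (b) the eigenspaces of $A^*$ have an ordering $\{V^*_i\}_{i=0}^{\delta}$ with $AV^*_i\subseteq V^*_{i-1}+V^*_i+V^*_{i+1}$ for $0\le i\le \delta$, where $V^*_{-1}=V^*_{\delta+1}=0$; (c) no subspace $W$ of $V$ with $W\ne 0$, $W\neq V$ satisfies $AW\subseteq W$ and $A^*W\subseteq W$. Orderings as in (a), (b) are called standard. A tridiagonal system on $V$ is a sequence $\Phi=(A;\{E_i\}_{i=0}^d;A^*;\{E^*_i\}_{i=0}^d)$ in which $A,A^*$ is a tridiagonal pair on $V$ and, for some standard orderings $\{V_i\}_{i=0}^d$ and $\{V^*_i\}_{i=0}^d$ of the eigenspaces of $A$ and $A^*$, $E_i$ (resp. $E^*_i$) is the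 projection of $V$ that is the identity on $V_i$ (resp. $V^*_i$) and zero on $V_j$ (resp. $V^*_j$) for $j\neq i$. Let $\theta_i$ (resp. $\theta^*_i$) be the eigenvalue of $A$ (resp. $A^*$) on $E_iV$ (resp. $E^*_iV$). The system $\Phi$ is sharp if $\dim E_0V=1$. Let $\Phi$ be a sharp tridiagonal system on $V$, and put $U_0=E^*_0V\cap(E_0V+E_1V+\cdots+E_dV)$. Then there are unique scalars $\{\zeta_i\}_{i=0}^d$ in $\mathbb{K}$ (the split sequence of $\Phi$) such that, for $0\le i\le d$, $$(A^*-\theta^*_1I)(A^*-\theta^*_2I)\cdots(A^*-\theta^*_iI)(A-\theta_{i-1}I)\cdots(A-\theta_1I)(A-\theta_0I)$$ acts on $U_0$ as multiplication by $\zeta_i$. Moreover, the parameter array $(\{\theta_i\}_{i=0}^d;\{\theta^*_i\}_{i=0}^d;\{\zeta_i\}_{i=0}^d)$ of $\Phi$ satisfies: (i) $\theta_i\neq\theta_j$ and $\theta^*_i\neq\theta^*_j$ whenever $i\neq j$ $(0\le i,j\le d)$; (ii) $\zeta_0=1$, $\zeta_d\neq 0$, and $$\sum_{i=0}^d \eta_{d-i}(\theta_0)\,\eta^*_{d-i}(\theta^*_0)\,\zeta_i\neq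 0,$$ where $\eta_i(\lambda)=(\lambda-\theta_d)(\lambda-\theta_{d-1})\cdots(\lambda-\theta_{d-i+1})$ and $\eta^*_i(\lambda)=(\lambda-\theta^*_d)(\lambda-\theta^*_{d-1})\cdots(\lambda-\theta^*_{d-i+1})$; (iii) the expressions $$\frac{\theta_{i-2}-\theta_{i+1}}{\theta_{i-1}-\theta_i},\qquad \frac{\theta^*_{i-2}-\theta^*_{i+1}}{\theta^*_{i-1}-\theta^*_i}$$ are equal and independent of $i$ for $2\le i\le d-1$. -/

import Mathlib

open scoped Polynomial

/-- `W` is an eigenspace of `A`: it is nonzero and of the form `{v | A v = θ v}`. -/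
def IsEigenspaceOf {K V : Type*} [Field K] [AddCommGroup V] [Module K V]
    (A : Module.End K V) (W : Submodule K V) : Prop :=
  W ≠ ⊥ ∧ ∃ θ : K, W = A.eigenspace θ

/-- `A` is diagonalizable: `V` is spanned by the eigenspaces of `A`. -/
def IsDiagonalizableEnd {K V : Type*} [Field K] [AddCommGroup V] [Module K V]
    (A : Module.End K V) : Prop :=
  ⨆ θ : K, A.eigenspace θ = ⊤

/-- `W 0, …, W d` is an ordering of the eigenspaces of `A`: each eigenspace of `A` is listed
exactly once and nothing else is listed. -/
def IsEigenspaceOrdering {K V : Type*} [Field K] [AddCommGroup V] [Module K V] {d : ℕ}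
    (A : Module.End K V) (W : Fin (d + 1) → Submodule K V) : Prop :=
  Function.Injective W ∧ Set.range W = {U | IsEigenspaceOf A U}

/-- `W 0, …, W d` is a standard ordering of the eigenspaces of `A` with respect to `B`:
`B (W i) ⊆ W (i-1) + W i + W (i+1)` for all `i`, where `W (-1) = W (d+1) = 0`. -/
def IsStandardOrdering {K V : Type*} [Field K] [AddCommGroup V] [Module K V] {d : ℕ}
    (A B : Module.End K V) (W : Fin (d + 1) → Submodule K V) : Prop :=
  IsEigenspaceOrdering A W ∧
    ∀ i : Fin (d + 1), (W i).map B ≤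
      ⨆ (j : Fin (d + 1)) (_ : (j : ℕ) ≤ (i : ℕ) + 1 ∧ (i : ℕ) ≤ (j : ℕ) + 1), W j

/-- The ordered pair `A, Astar` is a tridiagonal pair on `V`. -/
structure IsTridiagonalPair {K V : Type*} [Field K] [AddCommGroup V] [Module K V]
    (A Astar : Module.End K V) : Prop where
  diagonalizable : IsDiagonalizableEnd A
  diagonalizable_star : IsDiagonalizableEnd Astar
  exists_standard : ∃ (d : ℕ) (W : Fin (d + 1) → Submodule K V), IsStandardOrdering A Astar W
  exists_standard_star : ∃ (δ : ℕ) (W : Fin (δ + 1) → Submodule K V),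
    IsStandardOrdering Astar A W
  irreducible : ¬ ∃ W : Submodule K V, W.map A ≤ W ∧ W.map Astar ≤ W ∧ W ≠ ⊥ ∧ W ≠ ⊤

/-- `E 0, …, E d` are the primitive idempotents of the diagonalizable map whose eigenspaces are
`W 0, …, W d`: the map `E i` is the identity on `W i` and vanishes on `W j` for `j ≠ i`. -/
def ArePrimitiveIdempotents {K V : Type*} [Field K] [AddCommGroup V] [Module K V] {d : ℕ}
    (W : Fin (d + 1) → Submodule K V) (E : Fin (d + 1) → Module.End K V) : Prop :=
  ∀ i : Fin (d + 1), (∀ v ∈ W i, E i v = v) ∧ ∀ j : Fin (d + 1), j ≠ i → ∀ v ∈ W j, E i v = 0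

/-- `E 0, …, E d` is a standard ordering of the primitive idempotents of `A` with respect
to `B`. -/
def IsStandardIdempotentOrdering {K V : Type*} [Field K] [AddCommGroup V] [Module K V] {d : ℕ}
    (A B : Module.End K V) (E : Fin (d + 1) → Module.End K V) : Prop :=
  ∃ W : Fin (d + 1) → Submodule K V, IsStandardOrdering A B W ∧ ArePrimitiveIdempotents W E

/-- A tridiagonal system `(A; {E i}; Astar; {Estar i})` on `V`, of diameter `d`. -/
structure TridiagonalSystem (K V : Type*) [Field K] [AddCommGroup V] [Module K V] (d : ℕ) where
  A : Module.End K V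
  E : Fin (d + 1) → Module.End K V
  Astar : Module.End K V
  Estar : Fin (d + 1) → Module.End K V
  isTridiagonalPair : IsTridiagonalPair A Astar
  standard : IsStandardIdempotentOrdering A Astar E
  standard_star : IsStandardIdempotentOrdering Astar A Estar

/-- The polynomial `τ_i = (λ - θ_0)(λ - θ_1) ⋯ (λ - θ_{i-1})`. -/
noncomputable def tauPoly {K : Type*} [Field K] {d : ℕ} (θ : Fin (d + 1) → K) (i : ℕ) :
    K[X] :=
  ∏ j ∈ Finset.univ.filter (fun j : Fin (d + 1) => (j : ℕ) < i), (Polynomial.X - Polynomial.C (θ j))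

/-- The polynomial `η_i = (λ - θ_d)(λ - θ_{d-1}) ⋯ (λ - θ_{d-i+1})`. -/
noncomputable def etaPoly {K : Type*} [Field K] {d : ℕ} (θ : Fin (d + 1) → K) (i : ℕ) :
    K[X] :=
  ∏ j ∈ Finset.univ.filter (fun j : Fin (d + 1) => d < (j : ℕ) + i), (Polynomial.X - Polynomial.C (θ j))

/-- A sequence of scalars `({θ_i}; {θ*_i}; {ζ_i})`, `0 ≤ i ≤ d`. -/
@[ext]
structure ScalarArray (K : Type*) (d : ℕ) where
  θ : Fin (d + 1) → K
  θstar : Fin (d + 1) → K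
  ζ : Fin (d + 1) → K

namespace TridiagonalSystem

/-- The `i`-th term `ρ_i = dim E_i V` of the shape of the system. -/
noncomputable def shape {K V : Type*} [Field K] [AddCommGroup V] [Module K V] {d : ℕ}
    (Φ : TridiagonalSystem K V d) (i : Fin (d + 1)) : ℕ :=
  Module.finrank K (LinearMap.range (Φ.E i))

/-- The system is sharp: `ρ_0 = 1`. -/
def IsSharp {K V : Type*} [Field K] [AddCommGroup V] [Module K V] {d : ℕ}
    (Φ : TridiagonalSystem K V d) : Prop :=
  Φ.shape 0 = 1

/-- The `i`-th component of the split decomposition,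
`U_i = (E*_0 V + ⋯ + E*_i V) ∩ (E_i V + ⋯ + E_d V)`. -/
def splitComponent {K V : Type*} [Field K] [AddCommGroup V] [Module K V] {d : ℕ}
    (Φ : TridiagonalSystem K V d) (i : Fin (d + 1)) : Submodule K V :=
  (⨆ (j : Fin (d + 1)) (_ : j ≤ i), LinearMap.range (Φ.Estar j)) ⊓
    ⨆ (j : Fin (d + 1)) (_ : i ≤ j), LinearMap.range (Φ.E j)

/-- `θ_i` is the eigenvalue of `A` associated with the eigenspace `E_i V`. -/
def IsEigenvalueSequence {K V : Type*} [Field K] [AddCommGroup V] [Module K V] {d : ℕ}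
    (Φ : TridiagonalSystem K V d) (θ : Fin (d + 1) → K) : Prop :=
  ∀ i, LinearMap.range (Φ.E i) = Φ.A.eigenspace (θ i)

/-- `θ*_i` is the eigenvalue of `A*` associated with the eigenspace `E*_i V`. -/
def IsDualEigenvalueSequence {K V : Type*} [Field K] [AddCommGroup V] [Module K V] {d : ℕ}
    (Φ : TridiagonalSystem K V d) (θstar : Fin (d + 1) → K) : Prop :=
  ∀ i, LinearMap.range (Φ.Estar i) = Φ.Astar.eigenspace (θstar i)

/-- The map
`(A* - θ*_1 I)(A* - θ*_2 I) ⋯ (A* - θ*_i I)(A - θ_{i-1} I) ⋯ (A - θ_1 I)(A - θ_0 I)`. -/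
noncomputable def raiseLower {K V : Type*} [Field K] [AddCommGroup V] [Module K V] {d : ℕ}
    (Φ : TridiagonalSystem K V d) (θ θstar : Fin (d + 1) → K) (i : Fin (d + 1)) :
    Module.End K V :=
  Polynomial.aeval Φ.Astar
      (∏ j ∈ Finset.univ.filter (fun j : Fin (d + 1) => 1 ≤ (j : ℕ) ∧ j ≤ i),
        (Polynomial.X - Polynomial.C (θstar j))) *
    Polynomial.aeval Φ.A (tauPoly θ i)

/-- `p = ({θ_i}; {θ*_i}; {ζ_i})` is the parameter array of the (sharp) system: `{θ_i}` and
`{θ*_i}` are its eigenvalue and dual eigenvalue sequences, and `{ζ_i}` is its split sequence,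
that is, the map `raiseLower` with index `i` acts on the line `U_0` as multiplication
by `ζ_i`. -/
structure HasParameterArray {K V : Type*} [Field K] [AddCommGroup V] [Module K V] {d : ℕ}
    (Φ : TridiagonalSystem K V d) (p : ScalarArray K d) : Prop where
  eigenvalue : Φ.IsEigenvalueSequence p.θ
  dualEigenvalue : Φ.IsDualEigenvalueSequence p.θstar
  split : ∀ i, ∀ v ∈ Φ.splitComponent 0, Φ.raiseLower p.θ p.θstar i v = p.ζ i • v

end TridiagonalSystem

/-! Everything rests on two opposite flags. The sum F of the spaces (E*_0V+…+E*_{n-1}V) ∩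
(E_nV+…+E_dV) over all n is stable under A and A*, because A shifts n up and A* shifts it down
modulo scalars. It lies in E_1V+…+E_dV, so irreducibility gives F = 0 (`lowSum_inf_highSum`).
Exchanging A with A*, or reversing an ordering, yields the variants at the other ends.

Consequently η_d(A) maps E*_0V injectively into E_0V. For a sharp system E*_0V = U_0 is therefore a
line, and any operator preserving it acts as a scalar, which gives the ζ_i. Likewise τ_d(A) is
injective from E*_0V to E_dV, and (A*-θ*_1)⋯(A*-θ*_d) is injective on E_dV, so ζ_d ≠ 0. The sum in
(ii) is the scalar by which the injective map η*_d(A*)η_d(A) acts on U_0, as the expansion of η_d in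
the τ_i shows.

For (iii), take a polynomial p with p(θ_{i+1}) - p(θ_i) = θ_iθ_{i+1}(θ_{i+1}-θ_i). Tridiagonality
gives A²A*A - AA*A² = p(A)A* - A*p(A). Comparing leading terms along the flag of A* forces deg p ≤ 3
and the recurrence for θ*, with constant the coefficient of X³ in p. Divided differences of the
cubic p give the same recurrence for θ. -/

/-! ### Sums of eigenspaces as kernels of polynomials -/

section EigSum

variable {K V ι : Type*} [Field K] [AddCommGroup V] [Module K V]

/-- The sum of the eigenspaces of `A` for the eigenvalues `θ j`, `j ∈ S`, as a kernel. -/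
noncomputable def eigSum (A : Module.End K V) (θ : ι → K) (S : Finset ι) : Submodule K V :=
  LinearMap.ker (Polynomial.aeval A (∏ j ∈ S, (Polynomial.X - Polynomial.C (θ j))))

theorem mem_eigSum {A : Module.End K V} {θ : ι → K} {S : Finset ι} {v : V} :
    v ∈ eigSum A θ S ↔
      Polynomial.aeval A (∏ j ∈ S, (Polynomial.X - Polynomial.C (θ j))) v = 0 :=
  LinearMap.mem_ker

theorem eigSum_singleton (A : Module.End K V) (θ : ι → K) (i : ι) :
    eigSum A θ {i} = A.eigenspace (θ i) := by
  ext v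
  simp [mem_eigSum, sub_eq_zero]

theorem isCoprime_prod_X_sub_C {θ : ι → K} (hθ : Function.Injective θ) {S T : Finset ι}
    (h : Disjoint S T) :
    IsCoprime (∏ j ∈ S, (Polynomial.X - Polynomial.C (θ j)))
      (∏ j ∈ T, (Polynomial.X - Polynomial.C (θ j))) :=
  IsCoprime.prod_left fun _ hi => IsCoprime.prod_right fun _ hj =>
    Polynomial.pairwise_coprime_X_sub_C hθ (Finset.disjoint_iff_ne.1 h _ hi _ hj)

theorem disjoint_eigSum {A : Module.End K V} {θ : ι → K} (hθ : Function.Injective θ)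
    {S T : Finset ι} (h : Disjoint S T) : Disjoint (eigSum A θ S) (eigSum A θ T) :=
  Polynomial.disjoint_ker_aeval_of_isCoprime A (isCoprime_prod_X_sub_C hθ h)

theorem eigSum_union [DecidableEq ι] {A : Module.End K V} {θ : ι → K}
    (hθ : Function.Injective θ) {S T : Finset ι} (h : Disjoint S T) :
    eigSum A θ (S ∪ T) = eigSum A θ S ⊔ eigSum A θ T := by
  rw [eigSum, Finset.prod_union h]
  exact (Polynomial.sup_ker_aeval_eq_ker_aeval_mul_of_coprime A
    (isCoprime_prod_X_sub_C hθ h)).symm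

theorem eigSum_eq_iSup (A : Module.End K V) {θ : ι → K} (hθ : Function.Injective θ)
    (S : Finset ι) : eigSum A θ S = ⨆ j ∈ S, A.eigenspace (θ j) := by
  classical
  induction S using Finset.induction_on with
  | empty =>
    ext v
    simp [mem_eigSum]
  | insert i S hi ih =>
    rw [Finset.insert_eq, eigSum_union hθ (Finset.disjoint_singleton_left.2 hi),
      eigSum_singleton, ih, ← Finset.insert_eq, Finset.iSup_insert]

theorem eigSum_univ [Fintype ι] {A : Module.End K V} {θ : ι → K} (hθ : Function.Injective θ)
    (h : ⨆ i, A.eigenspace (θ i) = ⊤) : eigSum A θ Finset.univ = ⊤ := by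
  simpa [eigSum_eq_iSup A hθ] using h

theorem eigSum_mono {A : Module.End K V} {θ : ι → K} {S T : Finset ι} (h : S ⊆ T) :
    eigSum A θ S ≤ eigSum A θ T := by
  intro v hv
  obtain ⟨q, hq⟩ := Finset.prod_dvd_prod_of_subset S T
    (fun j => Polynomial.X - Polynomial.C (θ j)) h
  rw [mem_eigSum] at hv ⊢
  rw [hq, mul_comm, map_mul, Module.End.mul_apply, hv, map_zero]

theorem eigSum_empty (A : Module.End K V) (θ : ι → K) : eigSum A θ ∅ = ⊥ := by
  ext v
  simp [mem_eigSum]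

/-- The product over `T` kills the eigencomponents indexed by `T`, so only those in `R` can survive.
-/
theorem aeval_prod_mem_eigSum [DecidableEq ι] {A : Module.End K V} {θ : ι → K}
    {S R T : Finset ι} {v : V} (h : S ⊆ R ∪ T) (hv : v ∈ eigSum A θ S) :
    Polynomial.aeval A (∏ j ∈ T, (Polynomial.X - Polynomial.C (θ j))) v ∈ eigSum A θ R := by
  have hv' := mem_eigSum.1 (eigSum_mono h hv)
  rw [mem_eigSum, ← Module.End.mul_apply, ← map_mul, ← Finset.prod_union_inter, mul_comm,
    map_mul, Module.End.mul_apply, hv', map_zero]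

theorem sub_smul_mem_eigSum [DecidableEq ι] {A : Module.End K V} {θ : ι → K}
    {S R : Finset ι} {v : V} {i : ι} (h : S ⊆ insert i R) (hv : v ∈ eigSum A θ S) :
    A v - θ i • v ∈ eigSum A θ R := by
  have := aeval_prod_mem_eigSum (T := {i}) (R := R) (by simpa [Finset.union_comm] using h) hv
  simpa using this

theorem eigSum_comp_equiv {κ : Type*} (A : Module.End K V) (θ : ι → K) (e : κ ≃ ι)
    {S : Finset κ} {T : Finset ι} (h : ∀ k, k ∈ S ↔ e k ∈ T) :
    eigSum A (θ ∘ e) S = eigSum A θ T := by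
  have : ∏ j ∈ S, (Polynomial.X - Polynomial.C ((θ ∘ e) j)) =
      ∏ j ∈ T, (Polynomial.X - Polynomial.C (θ j)) :=
    Finset.prod_equiv e h fun _ _ => rfl
  rw [eigSum, this, eigSum]

end EigSum

/-! ### Eigenvalue data, opposite flags and powers of A -/

/-- The eigenvalue data of a tridiagonal system of diameter `d`. -/
structure TridiagonalData {K V : Type*} [Field K] [AddCommGroup V] [Module K V] {d : ℕ}
    (A B : Module.End K V) (θ θs : Fin (d + 1) → K) : Prop where
  injective : Function.Injective θ
  injective_star : Function.Injective θs
  ne_bot : ∀ i, A.eigenspace (θ i) ≠ ⊥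
  ne_bot_star : ∀ i, B.eigenspace (θs i) ≠ ⊥
  iSup_eq_top : ⨆ i, A.eigenspace (θ i) = ⊤
  iSup_eq_top_star : ⨆ i, B.eigenspace (θs i) = ⊤
  tridiagonal : ∀ i : Fin (d + 1), (A.eigenspace (θ i)).map B ≤
    ⨆ (j : Fin (d + 1)) (_ : (j : ℕ) ≤ (i : ℕ) + 1 ∧ (i : ℕ) ≤ (j : ℕ) + 1), A.eigenspace (θ j)
  tridiagonal_star : ∀ i : Fin (d + 1), (B.eigenspace (θs i)).map A ≤
    ⨆ (j : Fin (d + 1)) (_ : (j : ℕ) ≤ (i : ℕ) + 1 ∧ (i : ℕ) ≤ (j : ℕ) + 1), B.eigenspace (θs j)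
  irreducible : ∀ W : Submodule K V, W.map A ≤ W → W.map B ≤ W → W = ⊥ ∨ W = ⊤

namespace TridiagonalData

variable {K V : Type*} [Field K] [AddCommGroup V] [Module K V] {d : ℕ}
  {A B : Module.End K V} {θ θs : Fin (d + 1) → K}

theorem symm (h : TridiagonalData A B θ θs) : TridiagonalData B A θs θ where
  injective := h.injective_star
  injective_star := h.injective
  ne_bot := h.ne_bot_star
  ne_bot_star := h.ne_bot
  iSup_eq_top := h.iSup_eq_top_star
  iSup_eq_top_star := h.iSup_eq_top
  tridiagonal := h.tridiagonal_star
  tridiagonal_star := h.tridiagonal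
  irreducible W hA hB := h.irreducible W hB hA

/-- Adjacency of indices survives reversal. Together with `symm`, this transfers results about index
0 to index d. -/
theorem rev (h : TridiagonalData A B θ θs) : TridiagonalData A B (θ ∘ Fin.revPerm) θs where
  injective := h.injective.comp Fin.revPerm.injective
  injective_star := h.injective_star
  ne_bot i := h.ne_bot _
  ne_bot_star := h.ne_bot_star
  iSup_eq_top := by
    rw [← h.iSup_eq_top]
    exact Fin.revPerm.iSup_comp (g := fun i => A.eigenspace (θ i))
  iSup_eq_top_star := h.iSup_eq_top_star
  tridiagonal i := by
    refine (h.tridiagonal (Fin.revPerm i)).trans (iSup₂_le fun j hj => ?_)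
    refine le_iSup₂_of_le (Fin.revPerm j) ?_ ?_
    · simp only [Fin.revPerm_apply, Fin.val_rev] at hj ⊢
      omega
    · simp
  tridiagonal_star := h.tridiagonal_star
  irreducible := h.irreducible

theorem map_eigSum (h : TridiagonalData A B θ θs) {S T : Finset (Fin (d + 1))}
    (hST : ∀ i ∈ S, ∀ j : Fin (d + 1), (j : ℕ) ≤ (i : ℕ) + 1 → (i : ℕ) ≤ (j : ℕ) + 1 → j ∈ T)
    {v : V} (hv : v ∈ eigSum A θ S) : B v ∈ eigSum A θ T := by
  suffices hle : eigSum A θ S ≤ (eigSum A θ T).comap B from hle hv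
  rw [eigSum_eq_iSup A h.injective, eigSum_eq_iSup A h.injective]
  refine iSup₂_le fun i hi => Submodule.map_le_iff_le_comap.1 ((h.tridiagonal i).trans ?_)
  exact iSup₂_le fun j hj => le_iSup₂_of_le j (hST i hi j hj.1 hj.2) le_rfl

/-- By irreducibility, the two opposite flags are in general position. -/
theorem lowSum_inf_highSum (h : TridiagonalData A B θ θs) (n : ℕ) :
    eigSum B θs {j | (j : ℕ) < n} ⊓ eigSum A θ {j | n ≤ (j : ℕ)} = ⊥ := by
  set F : ℕ → Submodule K V := fun n =>
    eigSum B θs {j | (j : ℕ) < n} ⊓ eigSum A θ {j | n ≤ (j : ℕ)} with hF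
  have hzero : F 0 = ⊥ := by simp [hF, eigSum_empty]
  have hbig : ∀ n, d < n → F n = ⊥ := by
    intro n hn
    have : (Finset.univ.filter fun j : Fin (d + 1) => n ≤ (j : ℕ)) = ∅ := by
      ext j; simp; omega
    simp [hF, this, eigSum_empty]
  have hle : ∀ n, F n ≤ eigSum A θ {j | 1 ≤ (j : ℕ)} := by
    intro n
    rcases Nat.eq_zero_or_pos n with rfl | hn
    · rw [hzero]; exact bot_le
    · exact inf_le_right.trans (eigSum_mono fun j => by simp; omega)
  -- The sum of all `F n` is an invariant subspace. It cannot be everything, since it misses the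
  -- eigenspace for `θ 0`.
  have key := h.irreducible (⨆ n, F n) ?_ ?_
  · rcases key with key | key
    · exact (iSup_eq_bot.1 key) n
    · exfalso
      have htop : eigSum A θ {j | 1 ≤ (j : ℕ)} = ⊤ := top_le_iff.1 (key ▸ iSup_le hle)
      have hd := disjoint_eigSum (A := A) h.injective (S := {0})
        (T := {j : Fin (d + 1) | 1 ≤ (j : ℕ)}) (by simp)
      rw [htop, disjoint_top, eigSum_singleton] at hd
      exact h.ne_bot 0 hd
  · rw [Submodule.map_iSup]
    refine iSup_le fun n => ?_
    rintro _ ⟨v, hv, rfl⟩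
    by_cases hn : d < n
    · rw [SetLike.mem_coe, hbig n hn, Submodule.mem_bot] at hv
      simp [hv]
    · have h1 : A v - θ ⟨n, by omega⟩ • v ∈ F (n + 1) := by
        refine ⟨Submodule.sub_mem _ ?_ (Submodule.smul_mem _ _ ?_), ?_⟩
        · exact h.symm.map_eigSum (by simp; omega) hv.1
        · exact eigSum_mono (fun j => by simp; omega) hv.1
        · refine sub_smul_mem_eigSum ?_ hv.2
          intro j; simp [Fin.ext_iff]; omega
      have := Submodule.add_mem _ (Submodule.mem_iSup_of_mem (p := F) (n + 1) h1)
        (Submodule.smul_mem _ (θ ⟨n, by omega⟩) (Submodule.mem_iSup_of_mem (p := F) n hv))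
      simpa using this
  · rw [Submodule.map_iSup]
    refine iSup_le fun n => ?_
    rintro _ ⟨v, hv, rfl⟩
    by_cases hn : d < n
    · rw [SetLike.mem_coe, hbig n hn, Submodule.mem_bot] at hv
      simp [hv]
    · rcases n with _ | n
      · rw [SetLike.mem_coe, hzero, Submodule.mem_bot] at hv
        simp [hv]
      -- Dually, `B - θs n` sends `F (n + 1)` to `F n`.
      have h1 : B v - θs ⟨n, by omega⟩ • v ∈ F n := by
        refine ⟨?_, Submodule.sub_mem _ ?_ (Submodule.smul_mem _ _ ?_)⟩
        · refine sub_smul_mem_eigSum ?_ hv.1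
          intro j; simp [Fin.ext_iff]; omega
        · exact h.map_eigSum (by simp; omega) hv.2
        · exact eigSum_mono (fun j => by simp; omega) hv.2
      have := Submodule.add_mem _ (Submodule.mem_iSup_of_mem (p := F) n h1)
        (Submodule.smul_mem _ (θs ⟨n, by omega⟩) (Submodule.mem_iSup_of_mem (p := F) (n + 1) hv))
      simpa using this

theorem pow_mem_lowSum (h : TridiagonalData A B θ θs) {n : ℕ} {v : V}
    (hv : v ∈ eigSum B θs {j | (j : ℕ) < n}) (k : ℕ) :
    (A ^ k) v ∈ eigSum B θs {j | (j : ℕ) < n + k} := by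
  induction k with
  | zero => simpa using hv
  | succ k ih =>
    rw [pow_succ', Module.End.mul_apply]
    exact h.symm.map_eigSum (by simp; omega) ih

theorem lowSum_mono {B : Module.End K V} {θs : Fin (d + 1) → K} {m n : ℕ} (hmn : m ≤ n) :
    eigSum B θs {j | (j : ℕ) < m} ≤ eigSum B θs {j | (j : ℕ) < n} :=
  eigSum_mono fun j => by simp; omega

/-- Modulo the flag, only the top coefficient of a polynomial in `A` matters. -/
theorem aeval_sub_mem_lowSum (h : TridiagonalData A B θ θs) {n k : ℕ} {v : V}
    (hv : v ∈ eigSum B θs {j | (j : ℕ) < n + 1}) {q : K[X]} (hq : q.natDegree ≤ k) :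
    Polynomial.aeval A q v - q.coeff k • (A ^ k) v ∈ eigSum B θs {j | (j : ℕ) < n + k} := by
  rw [Polynomial.aeval_eq_sum_range' (Nat.lt_succ_of_le hq), Finset.sum_range_succ]
  simp only [LinearMap.add_apply, LinearMap.sum_apply, LinearMap.smul_apply, add_sub_cancel_right]
  refine Submodule.sum_mem _ fun i hi => Submodule.smul_mem _ _ ?_
  rw [Finset.mem_range] at hi
  exact lowSum_mono (by omega) (h.pow_mem_lowSum hv i)

theorem aeval_mem_lowSum (h : TridiagonalData A B θ θs) {n k : ℕ} {v : V}
    (hv : v ∈ eigSum B θs {j | (j : ℕ) < n}) {q : K[X]} (hq : q.natDegree ≤ k) :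
    Polynomial.aeval A q v ∈ eigSum B θs {j | (j : ℕ) < n + k} := by
  rw [Polynomial.aeval_eq_sum_range' (Nat.lt_succ_of_le hq)]
  simp only [LinearMap.sum_apply, LinearMap.smul_apply]
  refine Submodule.sum_mem _ fun i hi => Submodule.smul_mem _ _ ?_
  rw [Finset.mem_range] at hi
  exact lowSum_mono (by omega) (h.pow_mem_lowSum hv i)

theorem lowSum_one (B : Module.End K V) (θs : Fin (d + 1) → K) :
    eigSum B θs {j | (j : ℕ) < 1} = B.eigenspace (θs 0) := by
  rw [← eigSum_singleton]
  congr 1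
  ext j
  simp only [Finset.mem_filter_univ, Finset.mem_singleton, Fin.ext_iff, Fin.val_zero]
  omega

theorem natDegree_tauPoly (θ : Fin (d + 1) → K) {i : ℕ} (hi : i ≤ d + 1) :
    (tauPoly θ i).natDegree = i := by
  rw [tauPoly, Polynomial.natDegree_prod_of_monic _ _ fun j _ => Polynomial.monic_X_sub_C _]
  rw [Finset.sum_congr rfl fun j _ => Polynomial.natDegree_X_sub_C (θ j), ← Finset.card_eq_sum_ones,
    Fin.card_filter_val_lt, min_eq_right hi]

/-- The kernel of τ_d(A) is the sum of the eigenspaces for θ_0, …, θ_{d-1}. In the reversed ordering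
this is a high sum, which meets the eigenspace for `θs 0` trivially. -/
theorem eq_zero_of_aeval_tauPoly (h : TridiagonalData A B θ θs) {u : V}
    (hu : u ∈ B.eigenspace (θs 0)) (h0 : Polynomial.aeval A (tauPoly θ d) u = 0) : u = 0 := by
  have hb := h.rev.lowSum_inf_highSum 1
  rw [eigSum_comp_equiv A θ Fin.revPerm
    (T := {j | (j : ℕ) < d}) (fun k => by
      simp only [Finset.mem_filter_univ, Fin.revPerm_apply, Fin.val_rev]; omega), lowSum_one] at hb
  exact (Submodule.mem_bot K).1 (hb ▸ ⟨hu, mem_eigSum.2 h0⟩)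

theorem aeval_tauPoly_mem (h : TridiagonalData A B θ θs) (u : V) :
    Polynomial.aeval A (tauPoly θ d) u ∈ A.eigenspace (θ (Fin.last d)) := by
  have hu : u ∈ eigSum A θ Finset.univ := by
    rw [eigSum_univ h.injective h.iSup_eq_top]; trivial
  rw [← eigSum_singleton]
  refine aeval_prod_mem_eigSum ?_ hu
  intro j
  simp [Fin.ext_iff]; omega

/-- A drop in the flag at step `i` would persist up to step `d`. Then τ_d(A)u would lie both in the
low sum of the first d eigenspaces of `B` and in the eigenspace for θ_d, hence vanish, although
τ_d(A) is injective there. -/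
theorem pow_notMem_lowSum (h : TridiagonalData A B θ θs) {u : V}
    (hu : u ∈ B.eigenspace (θs 0)) (hu0 : u ≠ 0) {i : ℕ} (hi : i ≤ d) :
    (A ^ i) u ∉ eigSum B θs {j | (j : ℕ) < i} := by
  intro hmem
  have hd : (A ^ d) u ∈ eigSum B θs {j | (j : ℕ) < d} := by
    have := h.pow_mem_lowSum hmem (d - i)
    rwa [← Module.End.mul_apply, ← pow_add, Nat.sub_add_cancel hi, Nat.add_sub_cancel' hi] at this
  have hu1 : u ∈ eigSum B θs {j | (j : ℕ) < 0 + 1} := by rw [zero_add, lowSum_one]; exact hu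
  have h1 := h.aeval_sub_mem_lowSum hu1 (q := tauPoly θ d) (natDegree_tauPoly θ (by omega)).le
  have h2 : Polynomial.aeval A (tauPoly θ d) u ∈ eigSum B θs {j | (j : ℕ) < d} := by
    have := Submodule.add_mem _ (by simpa using h1)
      (Submodule.smul_mem _ ((tauPoly θ d).coeff d) hd)
    simpa using this
  have h3 : Polynomial.aeval A (tauPoly θ d) u ∈ eigSum A θ {j | d ≤ (j : ℕ)} := by
    have := h.aeval_tauPoly_mem u
    rw [← eigSum_singleton] at this
    exact eigSum_mono (by simp) this
  exact hu0 (h.eq_zero_of_aeval_tauPoly hu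
    ((Submodule.mem_bot K).1 (h.lowSum_inf_highSum d ▸ ⟨h2, h3⟩)))

/-- The vector is the θ*_i-component of A^i u, for nonzero u in the eigenspace of `θs 0`. The
remaining components lie lower in the flag and cannot affect the leading term. -/
theorem exists_eigenvector_pow_notMem (h : TridiagonalData A B θ θs) (i : Fin (d + 1)) :
    ∃ y ∈ B.eigenspace (θs i), ∀ k, (i : ℕ) + k ≤ d →
      (A ^ k) y ∉ eigSum B θs {j | (j : ℕ) < i + k} := by
  obtain ⟨u, hu, hu0⟩ := Submodule.exists_mem_ne_zero_of_ne_bot (h.ne_bot_star 0)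
  have hu1 : u ∈ eigSum B θs {j | (j : ℕ) < 1} := by rw [lowSum_one]; exact hu
  have h1 := h.pow_mem_lowSum hu1 i
  have hS : (Finset.univ.filter fun j : Fin (d + 1) => (j : ℕ) < 1 + i) =
      (Finset.univ.filter fun j : Fin (d + 1) => (j : ℕ) < i) ∪ {i} := by
    ext j; simp [Fin.ext_iff]; omega
  rw [hS, eigSum_union h.injective_star (by simp), eigSum_singleton] at h1
  obtain ⟨f, hf, y, hy, hfy⟩ := Submodule.mem_sup.1 h1
  refine ⟨y, hy, fun k hk hmem => h.pow_notMem_lowSum hu hu0 hk ?_⟩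
  have hpow : (A ^ ((i : ℕ) + k)) u = (A ^ k) f + (A ^ k) y := by
    rw [add_comm, pow_add, Module.End.mul_apply, ← hfy, map_add]
  rw [hpow]
  exact Submodule.add_mem _ (h.pow_mem_lowSum hf k) hmem

end TridiagonalData

/-! ### The common recurrence of the two eigenvalue sequences -/

namespace TridiagonalData

variable {K V : Type*} [Field K] [AddCommGroup V] [Module K V] {d : ℕ}
  {A B : Module.End K V} {θ θs : Fin (d + 1) → K}

theorem aeval_apply_of_mem_eigenspace {A : Module.End K V} {c : K} {y : V}
    (hy : y ∈ A.eigenspace c) (p : K[X]) : Polynomial.aeval A p y = p.eval c • y := by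
  rcases eq_or_ne y 0 with rfl | hy0
  · simp
  · exact Module.End.aeval_apply_of_hasEigenvector ⟨hy, hy0⟩

theorem exists_interpolating_poly (θ : Fin (d + 1) → K) (hθ : Function.Injective θ) :
    ∃ p : K[X], p.natDegree ≤ d ∧ ∀ i j : Fin (d + 1), (j : ℕ) = i + 1 →
      p.eval (θ j) - p.eval (θ i) = θ i * θ j * (θ j - θ i) := by
  -- The prescribed values `r` are telescoping sums of the required differences. The default value 0
  -- of `t` is never used.
  let t : ℕ → K := fun n => if hn : n < d + 1 then θ ⟨n, hn⟩ else 0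
  let r : Fin (d + 1) → K := fun i =>
    ∑ k ∈ Finset.range i, t k * t (k + 1) * (t (k + 1) - t k)
  refine ⟨Lagrange.interpolate Finset.univ θ r, ?_, fun i j hij => ?_⟩
  · have := Lagrange.degree_interpolate_lt r (s := Finset.univ) hθ.injOn
    rw [Finset.card_univ, Fintype.card_fin] at this
    refine Polynomial.natDegree_le_iff_coeff_eq_zero.2 fun N hN =>
      Polynomial.coeff_eq_zero_of_degree_lt (this.trans_le ?_)
    exact_mod_cast hN
  · rw [Lagrange.eval_interpolate_at_node r hθ.injOn (Finset.mem_univ _),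
      Lagrange.eval_interpolate_at_node r hθ.injOn (Finset.mem_univ _)]
    have hi : t i = θ i := dif_pos i.2
    have hj : t (i + 1) = θ j := by
      rw [← hij]; exact dif_pos j.2
    simp only [r]
    rw [hij, Finset.sum_range_succ, add_sub_cancel_left, hi, hj]

/-- The tridiagonal relation in commutator form. -/
theorem commutator_relation (h : TridiagonalData A B θ θs) {p : K[X]}
    (hp : ∀ i j : Fin (d + 1), (j : ℕ) = i + 1 →
      p.eval (θ j) - p.eval (θ i) = θ i * θ j * (θ j - θ i)) (v : V) :
    (A ^ 2) (B (A v)) - A (B ((A ^ 2) v)) =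
      Polynomial.aeval A p (B v) - B (Polynomial.aeval A p v) := by
  have hv : v ∈ ⨆ i, A.eigenspace (θ i) := by rw [h.iSup_eq_top]; trivial
  induction hv using Submodule.iSup_induction' with
  | zero => simp
  | add x y _ _ hx hy =>
    simp only [map_add]
    rw [add_sub_add_comm, hx, hy, add_sub_add_comm]
  | mem i y hy =>
    -- On an eigenvector for θ_i the relation says that a polynomial in `A` kills `B y`. By
    -- tridiagonality it is enough that this polynomial vanishes at θ_j for |i - j| ≤ 1.
    have hle := (h.tridiagonal i).trans (b := ⨆ (j : Fin (d + 1))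
      (_ : (j : ℕ) ≤ (i : ℕ) + 1 ∧ (i : ℕ) ≤ (j : ℕ) + 1), A.eigenspace (θ j))
      (c := LinearMap.ker (Polynomial.aeval A (Polynomial.C (θ i) * Polynomial.X ^ 2 -
        Polynomial.C (θ i ^ 2) * Polynomial.X - p + Polynomial.C (p.eval (θ i)))))
      (iSup₂_le fun j hj z hz => ?_)
    · have hBy := LinearMap.mem_ker.1 (hle ⟨y, hy, rfl⟩)
      have hpy : Polynomial.aeval A p y = p.eval (θ i) • y :=
        aeval_apply_of_mem_eigenspace hy p
      rw [Module.End.mem_eigenspace_iff] at hy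
      simp only [map_add, map_sub, map_mul, map_pow, Polynomial.aeval_C, Polynomial.aeval_X,
        LinearMap.add_apply, LinearMap.sub_apply, Module.End.mul_apply,
        Module.algebraMap_end_apply] at hBy
      simp only [hpy, hy, pow_two, Module.End.mul_apply, map_smul, smul_smul,
        Module.algebraMap_end_apply] at hBy ⊢
      rw [← sub_eq_zero, ← hBy]
      module
    · rw [LinearMap.mem_ker, aeval_apply_of_mem_eigenspace hz]
      simp only [Polynomial.eval_add, Polynomial.eval_sub, Polynomial.eval_mul,
        Polynomial.eval_pow, Polynomial.eval_C, Polynomial.eval_X]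
      have hz0 : θ i * θ j ^ 2 - θ i ^ 2 * θ j - p.eval (θ j) + p.eval (θ i) = 0 := by
        rcases Nat.lt_trichotomy (i : ℕ) j with hij | hij | hij
        · have := hp i j (by omega)
          linear_combination -this
        · rw [Fin.ext hij]; ring
        · have := hp j i (by omega)
          linear_combination this
      rw [hz0, zero_smul]

theorem sub_smul_mem_lowSum {B : Module.End K V} {θs : Fin (d + 1) → K} {i : Fin (d + 1)} {v : V}
    {n : ℕ} (hn : n = i + 1) (hv : v ∈ eigSum B θs {j | (j : ℕ) < n}) :
    B v - θs i • v ∈ eigSum B θs {j | (j : ℕ) < i} := by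
  refine sub_smul_mem_eigSum ?_ hv
  intro j
  simp [Fin.ext_iff]; omega

theorem eigenspace_le_lowSum {B : Module.End K V} {θs : Fin (d + 1) → K} (i : Fin (d + 1)) :
    B.eigenspace (θs i) ≤ eigSum B θs {j | (j : ℕ) < i + 1} := by
  rw [← eigSum_singleton]
  exact eigSum_mono (by simp)

/-- Modulo the flag, p(A)y is its top term, and `B` acts on the layer `j = i + k` as the scalar
θ*_j. -/
theorem commutator_mod_lowSum (h : TridiagonalData A B θ θs) {p : K[X]} {k : ℕ}
    (hpk : p.natDegree ≤ k) {i j : Fin (d + 1)} (hij : (j : ℕ) = i + k) {y : V}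
    (hy : y ∈ B.eigenspace (θs i)) :
    (Polynomial.aeval A p (B y) - B (Polynomial.aeval A p y)) -
      (p.coeff k * (θs i - θs j)) • (A ^ k) y ∈ eigSum B θs {l | (l : ℕ) < i + k} := by
  have hy1 := eigenspace_le_lowSum i hy
  have h1 := h.aeval_sub_mem_lowSum hy1 hpk
  have h2 := sub_smul_mem_lowSum (i := j) (by omega) (h.aeval_mem_lowSum hy1 hpk)
  rw [hij] at h2
  rw [Module.End.mem_eigenspace_iff.1 hy, map_smul]
  have := Submodule.sub_mem _ (Submodule.smul_mem _ (θs i - θs j) h1) h2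
  convert this using 1
  module

/-- `B` acts as θ*_{i+1} on the leading part of A y and as θ*_{i+2} on that of A²y. Further powers
of `A` shift the errors only up to level i + 3. -/
theorem cubic_mod_lowSum (h : TridiagonalData A B θ θs) {i i1 i2 : Fin (d + 1)}
    (h1 : (i1 : ℕ) = i + 1) (h2 : (i2 : ℕ) = i + 2) {y : V} (hy : y ∈ B.eigenspace (θs i)) :
    ((A ^ 2) (B (A y)) - A (B ((A ^ 2) y))) - (θs i1 - θs i2) • (A ^ 3) y ∈
      eigSum B θs {l | (l : ℕ) < i + 3} := by
  have hy1 := eigenspace_le_lowSum i hy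
  have ha := h.pow_mem_lowSum (sub_smul_mem_lowSum (i := i1) (by omega) (h.pow_mem_lowSum hy1 1)) 2
  have hb := h.pow_mem_lowSum (sub_smul_mem_lowSum (i := i2) (by omega) (h.pow_mem_lowSum hy1 2)) 1
  rw [h1] at ha
  rw [h2] at hb
  have := Submodule.sub_mem _ ha hb
  convert this using 1
  simp only [pow_succ, pow_zero, one_mul, Module.End.mul_apply, map_sub, map_smul]
  module

/-- The recurrence for the two eigenvalue sequences. -/
theorem exists_recurrence (h : TridiagonalData A B θ θs) (hd : 3 ≤ d) :
    ∃ c : K, c ≠ 0 ∧ ∀ i j k l : Fin (d + 1), (j : ℕ) = i + 1 → (k : ℕ) = i + 2 →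
      (l : ℕ) = i + 3 → θ j - θ k = c * (θ i - θ l) ∧ θs j - θs k = c * (θs i - θs l) := by
  obtain ⟨p, hpd, hp⟩ := exists_interpolating_poly θ h.injective
  have hrel := h.commutator_relation hp
  -- If n = deg p exceeded 3, the cubic side would lie below layer n, while the commutator has
  -- leading term a nonzero multiple of A^n y.
  have hdeg : p.natDegree ≤ 3 := by
    by_contra! hlt
    obtain ⟨y, hy, hyk⟩ := h.exists_eigenvector_pow_notMem 0
    set n := p.natDegree with hn
    let j : Fin (d + 1) := ⟨n, by omega⟩
    have h1 := h.commutator_mod_lowSum hn.ge (i := 0) (j := j) (by simp [j]) hy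
    have hy1 := eigenspace_le_lowSum 0 hy
    have h2 : (A ^ 2) (B (A y)) - A (B ((A ^ 2) y)) ∈
        eigSum B θs {l | (l : ℕ) < (0 : Fin (d + 1)) + n} := by
      have e1 := h.cubic_mod_lowSum (i := 0) (i1 := ⟨1, by omega⟩) (i2 := ⟨2, by omega⟩)
        (by simp) (by simp) hy
      have e2 := h.pow_mem_lowSum hy1 3
      have := Submodule.add_mem _ (lowSum_mono (by simp; omega) e1)
        (Submodule.smul_mem _ (θs ⟨1, by omega⟩ - θs ⟨2, by omega⟩)
          (lowSum_mono (n := (0 : Fin (d + 1)) + n) (by simp; omega) e2))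
      simpa using this
    rw [← hrel] at h1
    have h3 := Submodule.sub_mem _ h2 h1
    rw [sub_sub_cancel] at h3
    refine hyk n (by simp; omega) ((Submodule.smul_mem_iff _ ?_).1 h3)
    refine mul_ne_zero ?_ (sub_ne_zero.2 fun he => ?_)
    · rw [hn, Polynomial.coeff_natDegree, Polynomial.leadingCoeff_ne_zero]
      rintro rfl
      simp at hn; omega
    · have := congrArg Fin.val (h.injective_star he)
      simp [j] at this
      omega
  -- Both sides of the commutator relation have an A³y term modulo the flag. Since A³y is not in the
  -- flag, the coefficients agree.
  have hstar : ∀ i j k l : Fin (d + 1), (j : ℕ) = i + 1 → (k : ℕ) = i + 2 →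
      (l : ℕ) = i + 3 → θs j - θs k = p.coeff 3 * (θs i - θs l) := by
    intro i j k l hj hk hl
    obtain ⟨y, hy, hyk⟩ := h.exists_eigenvector_pow_notMem i
    have h1 := h.commutator_mod_lowSum hdeg hl hy
    have h2 := h.cubic_mod_lowSum hj hk hy
    rw [← hrel] at h1
    have h3 := Submodule.sub_mem _ h1 h2
    rw [sub_sub_sub_cancel_left, ← sub_smul] at h3
    by_contra hne
    exact hyk 3 (by omega) ((Submodule.smul_mem_iff _ (sub_ne_zero.2 hne)).1 h3)
  refine ⟨p.coeff 3, fun h0 => ?_, fun i j k l hj hk hl => ⟨?_, hstar i j k l hj hk hl⟩⟩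
  · have := hstar 0 ⟨1, by omega⟩ ⟨2, by omega⟩ ⟨3, by omega⟩ (by simp) (by simp) (by simp)
    rw [h0, zero_mul, sub_eq_zero] at this
    simpa using h.injective_star this
  · have hev : ∀ x : K, p.eval x =
        p.coeff 0 + p.coeff 1 * x + p.coeff 2 * x ^ 2 + p.coeff 3 * x ^ 3 := by
      intro x
      rw [Polynomial.eval_eq_sum_range' (Nat.lt_succ_of_le hdeg)]
      simp [Finset.sum_range_succ]
    have hne : ∀ a b : Fin (d + 1), (a : ℕ) ≠ b → θ a - θ b ≠ 0 := fun a b hab =>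
      sub_ne_zero.2 fun he => hab (congrArg Fin.val (h.injective he))
    -- First divided difference of the cubic `p`; `step2` is the second, and subtracting two
    -- consecutive instances of it gives the recurrence.
    have step : ∀ a b : Fin (d + 1), (b : ℕ) = a + 1 → θ a * θ b =
        p.coeff 1 + p.coeff 2 * (θ a + θ b) +
          p.coeff 3 * (θ a ^ 2 + θ a * θ b + θ b ^ 2) := by
      intro a b hab
      have := hp a b hab
      rw [hev, hev] at this
      refine mul_right_cancel₀ (hne b a (by omega)) ?_
      linear_combination -this
    have step2 : ∀ a b c : Fin (d + 1), (b : ℕ) = a + 1 → (c : ℕ) = a + 2 →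
        θ b = p.coeff 2 + p.coeff 3 * (θ a + θ b + θ c) := by
      intro a b c hab hac
      refine mul_right_cancel₀ (hne a c (by omega)) ?_
      linear_combination step a b hab - step b c (by omega)
    linear_combination step2 i j k hj hk - step2 j k l (by omega) (by omega)

end TridiagonalData

/-! ### Expansion of η_d in the polynomials τ_i -/

/-- Induction on n by writing x - t_{n+1} = (t_0 - t_{n+1}) + (x - t_0): the first part extends the
old coefficients, the second produces the new top term. -/
theorem Finset.prod_sub_expansion {R : Type*} [CommRing R] (t : ℕ → R) (x : R) (n : ℕ) :
    ∏ j ∈ Finset.Icc 1 n, (x - t j) =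
      ∑ i ∈ Finset.range (n + 1),
        (∏ j ∈ Finset.Ioc i n, (t 0 - t j)) * ∏ j ∈ Finset.range i, (x - t j) := by
  induction n with
  | zero => simp
  | succ n ih =>
    have hsum : ∑ i ∈ Finset.range (n + 1),
        (∏ j ∈ Finset.Ioc i (n + 1), (t 0 - t j)) * ∏ j ∈ Finset.range i, (x - t j) =
        (t 0 - t (n + 1)) * ∏ j ∈ Finset.Icc 1 n, (x - t j) := by
      rw [ih, Finset.mul_sum]
      refine Finset.sum_congr rfl fun i hi => ?_
      rw [Finset.mem_range] at hi
      rw [← Finset.insert_Ioc_right_eq_Ioc_add_one (by omega), Finset.prod_insert (by simp)]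
      ring
    have : ∏ k ∈ Finset.range n, (x - t (k + 1)) = ∏ j ∈ Finset.Icc 1 n, (x - t j) := by
      rw [Finset.range_eq_Ico, Finset.prod_Ico_add' (fun j => x - t j) 0 n 1]
      rfl
    rw [Finset.sum_range_succ, hsum, Finset.Ioc_self, Finset.prod_empty, one_mul,
      Finset.prod_range_succ', this, Finset.prod_Icc_succ_top (by omega)]
    ring

theorem Fin.prod_filter_eq_prod_nat {M : Type*} [CommMonoid M] {n : ℕ} {P : ℕ → Prop}
    [DecidablePred P] {T : Finset ℕ} (hT : ∀ j, j ∈ T ↔ j < n ∧ P j) {f : Fin n → M} {g : ℕ → M}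
    (hfg : ∀ j : Fin n, f j = g j) :
    ∏ j ∈ Finset.univ.filter (fun j : Fin n => P j), f j = ∏ j ∈ T, g j := by
  refine Finset.prod_nbij (fun j => (j : ℕ)) (fun j hj => ?_) (fun i _ j _ hij => Fin.ext hij)
    (fun j hj => ?_) fun j _ => hfg j
  · exact (hT _).2 ⟨j.2, by simpa using hj⟩
  · obtain ⟨h1, h2⟩ := (hT _).1 hj
    exact ⟨⟨j, h1⟩, by simpa using h2, rfl⟩

theorem etaPoly_expansion {K : Type*} [Field K] {d : ℕ} (θ : Fin (d + 1) → K) :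
    etaPoly θ d = ∑ i : Fin (d + 1),
      Polynomial.C ((etaPoly θ (d - (i : ℕ))).eval (θ 0)) * tauPoly θ i := by
  let t : ℕ → K[X] := fun n => if hn : n < d + 1 then Polynomial.C (θ ⟨n, hn⟩) else 0
  have ht : ∀ j : Fin (d + 1), Polynomial.C (θ j) = t j := fun j => by
    simp only [t, j.2, dif_pos]
  have h := Finset.prod_sub_expansion t Polynomial.X d
  rw [Finset.sum_range] at h
  rw [etaPoly, Fin.prod_filter_eq_prod_nat (P := fun j => d < j + d) (T := Finset.Icc 1 d)
    (by simp only [Finset.mem_Icc]; omega) (g := fun j => Polynomial.X - t j)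
    (fun j => by rw [ht]), h]
  refine Finset.sum_congr rfl fun i _ => ?_
  rw [tauPoly, Fin.prod_filter_eq_prod_nat (P := fun j => j < (i : ℕ)) (T := Finset.range i)
    (by simp only [Finset.mem_range]; omega) (g := fun j => Polynomial.X - t j)
    (fun j => by rw [ht]), etaPoly, Polynomial.eval_prod, map_prod,
    Fin.prod_filter_eq_prod_nat (P := fun j => d < j + (d - i)) (T := Finset.Ioc i d)
    (by simp only [Finset.mem_Ioc]; omega) (g := fun j => t 0 - t j)
    (fun j => by
      rw [Polynomial.eval_sub, Polynomial.eval_X, Polynomial.eval_C, map_sub, ht, ht]; rfl)]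

/-! ### Injectivity at the ends and the split sequence -/

namespace TridiagonalData

variable {K V : Type*} [Field K] [AddCommGroup V] [Module K V] {d : ℕ}
  {A B : Module.End K V} {θ θs : Fin (d + 1) → K}

theorem aeval_etaPoly_mem (h : TridiagonalData A B θ θs) (u : V) :
    Polynomial.aeval A (etaPoly θ d) u ∈ A.eigenspace (θ 0) := by
  have hu : u ∈ eigSum A θ Finset.univ := by
    rw [eigSum_univ h.injective h.iSup_eq_top]; trivial
  rw [← lowSum_one]
  refine aeval_prod_mem_eigSum ?_ hu
  intro j
  simp only [Finset.mem_union, Finset.mem_filter_univ, Finset.mem_univ]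
  omega

theorem eq_zero_of_aeval_etaPoly (h : TridiagonalData A B θ θs) {u : V}
    (hu : u ∈ B.eigenspace (θs 0)) (h0 : Polynomial.aeval A (etaPoly θ d) u = 0) : u = 0 := by
  have hb := h.lowSum_inf_highSum 1
  rw [lowSum_one] at hb
  refine (Submodule.mem_bot K).1 (hb ▸ ⟨hu, ?_⟩)
  exact eigSum_mono (fun j => by simp only [Finset.mem_filter_univ]; omega) (mem_eigSum.2 h0)

/-- η_d(A) embeds one eigenspace into the other; this is how sharpness at E_0V reaches E*_0V. -/
theorem finrank_star_le [FiniteDimensional K V] (h : TridiagonalData A B θ θs) :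
    Module.finrank K (B.eigenspace (θs 0)) ≤ Module.finrank K (A.eigenspace (θ 0)) := by
  let f : B.eigenspace (θs 0) →ₗ[K] A.eigenspace (θ 0) :=
    LinearMap.codRestrict _ ((Polynomial.aeval A (etaPoly θ d)).comp (Submodule.subtype _))
      fun u => h.aeval_etaPoly_mem u
  refine LinearMap.finrank_le_finrank_of_injective (f := f) ?_
  rw [← LinearMap.ker_eq_bot, LinearMap.ker_eq_bot']
  intro u hu
  exact Subtype.ext (h.eq_zero_of_aeval_etaPoly u.2 (congrArg Subtype.val hu))

theorem eq_zero_of_aeval_raise (h : TridiagonalData A B θ θs) {w : V}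
    (hw : w ∈ A.eigenspace (θ (Fin.last d)))
    (h0 : Polynomial.aeval B (∏ j ∈ Finset.univ.filter (fun j : Fin (d + 1) => 1 ≤ (j : ℕ)),
      (Polynomial.X - Polynomial.C (θs j))) w = 0) : w = 0 := by
  have hb := h.rev.symm.lowSum_inf_highSum 1
  rw [lowSum_one, Function.comp_apply, Fin.revPerm_apply, Fin.rev_zero] at hb
  exact (Submodule.mem_bot K).1 (hb ▸ ⟨hw, mem_eigSum.2 h0⟩)

/-- The map that defines the split sequence preserves the eigenspace of `B` for `θs 0`. -/
theorem aeval_raise_tauPoly_mem (h : TridiagonalData A B θ θs) (i : Fin (d + 1)) {u : V}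
    (hu : u ∈ B.eigenspace (θs 0)) :
    Polynomial.aeval B (∏ j ∈ Finset.univ.filter (fun j : Fin (d + 1) => 1 ≤ (j : ℕ) ∧ j ≤ i),
      (Polynomial.X - Polynomial.C (θs j))) (Polynomial.aeval A (tauPoly θ i) u) ∈
      B.eigenspace (θs 0) := by
  rw [← lowSum_one] at hu ⊢
  -- τ_i(A)u has components only at indices 0, …, i, and the product removes 1, …, i.
  refine aeval_prod_mem_eigSum ?_ (h.aeval_mem_lowSum hu (natDegree_tauPoly θ i.2.le).le)
  intro j
  simp only [Finset.mem_union, Finset.mem_filter_univ, Fin.le_def]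
  omega

theorem etaPoly_eq_mul (θ : Fin (d + 1) → K) (i : Fin (d + 1)) :
    etaPoly θ d = etaPoly θ (d - i) *
      ∏ j ∈ Finset.univ.filter (fun j : Fin (d + 1) => 1 ≤ (j : ℕ) ∧ j ≤ i),
        (Polynomial.X - Polynomial.C (θ j)) := by
  rw [etaPoly, etaPoly, ← Finset.prod_union]
  · congr 1
    ext j
    simp only [Finset.mem_union, Finset.mem_filter_univ, Fin.le_def]
    omega
  · rw [Finset.disjoint_filter]
    simp only [Fin.le_def]
    omega

/-- The sum is the eigenvalue of η*_d(B)η_d(A) at `u`. Each factor is injective on the eigenspace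
where it is applied, so the eigenvalue is nonzero. -/
theorem split_sum_ne_zero (h : TridiagonalData A B θ θs) {u : V}
    (hu : u ∈ B.eigenspace (θs 0)) (hu0 : u ≠ 0) {ζ : Fin (d + 1) → K}
    (hζ : ∀ i : Fin (d + 1),
      Polynomial.aeval B (∏ j ∈ Finset.univ.filter (fun j : Fin (d + 1) => 1 ≤ (j : ℕ) ∧ j ≤ i),
        (Polynomial.X - Polynomial.C (θs j))) (Polynomial.aeval A (tauPoly θ i) u) = ζ i • u) :
    ∑ i : Fin (d + 1), (etaPoly θ (d - (i : ℕ))).eval (θ 0) *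
      (etaPoly θs (d - (i : ℕ))).eval (θs 0) * ζ i ≠ 0 := by
  intro hsum
  have hne : Polynomial.aeval A (etaPoly θ d) u ≠ 0 := fun h0 =>
    hu0 (h.eq_zero_of_aeval_etaPoly hu h0)
  refine hne (h.symm.eq_zero_of_aeval_etaPoly (h.aeval_etaPoly_mem u) ?_)
  rw [etaPoly_expansion θ, map_sum, LinearMap.sum_apply, map_sum]
  have hterm : ∀ i : Fin (d + 1), Polynomial.aeval B (etaPoly θs d) (Polynomial.aeval A
      (Polynomial.C ((etaPoly θ (d - (i : ℕ))).eval (θ 0)) * tauPoly θ i) u) =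
      ((etaPoly θ (d - (i : ℕ))).eval (θ 0) *
        (etaPoly θs (d - (i : ℕ))).eval (θs 0) * ζ i) • u := by
    intro i
    -- η*_d is split as η*_{d-i} times the factors 1, …, i. The latter turn τ_i(A)u into ζ_i u, on
    -- which η*_{d-i}(B) acts by its value at θ*_0.
    rw [map_mul, Polynomial.aeval_C, Module.End.mul_apply, Module.algebraMap_end_apply, map_smul,
      etaPoly_eq_mul θs i, map_mul, Module.End.mul_apply, hζ, map_smul,
      aeval_apply_of_mem_eigenspace hu, smul_smul, smul_smul]
    congr 1
    ring
  rw [Finset.sum_congr rfl fun i _ => hterm i, ← Finset.sum_smul, hsum, zero_smul]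

end TridiagonalData

/-! ### Eigenvalue data and split sequence of a tridiagonal system -/

namespace TridiagonalSystem

variable {K V : Type*} [Field K] [AddCommGroup V] [Module K V] {d : ℕ}

theorem range_eq_of_arePrimitiveIdempotents {A : Module.End K V}
    (hA : IsDiagonalizableEnd A) {W : Fin (d + 1) → Submodule K V}
    (hW : IsEigenspaceOrdering A W) {E : Fin (d + 1) → Module.End K V}
    (hE : ArePrimitiveIdempotents W E) (i : Fin (d + 1)) : LinearMap.range (E i) = W i := by
  refine le_antisymm ?_ fun v hv => ⟨v, (hE i).1 v hv⟩
  rw [LinearMap.range_eq_map, ← hA, Submodule.map_iSup]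
  refine iSup_le fun c => ?_
  rintro _ ⟨v, hv, rfl⟩
  by_cases hc : A.eigenspace c = ⊥
  · rw [SetLike.mem_coe, hc, Submodule.mem_bot] at hv
    simp [hv]
  · obtain ⟨j, hj⟩ : A.eigenspace c ∈ Set.range W := by
      rw [hW.2]; exact ⟨hc, c, rfl⟩
    rw [SetLike.mem_coe, ← hj] at hv
    rcases eq_or_ne j i with rfl | hji
    · rw [(hE j).1 v hv]; exact hv
    · rw [(hE i).2 j hji v hv]; exact zero_mem _

theorem exists_eigenvalues {A : Module.End K V} {W : Fin (d + 1) → Submodule K V}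
    (hW : IsEigenspaceOrdering A W) : ∃ θ : Fin (d + 1) → K, ∀ i, W i = A.eigenspace (θ i) := by
  have : ∀ i, ∃ c, W i = A.eigenspace c := fun i => by
    have hi : W i ∈ {U | IsEigenspaceOf A U} := hW.2 ▸ ⟨i, rfl⟩
    exact hi.2
  exact Classical.axiomOfChoice this

theorem ordering_facts {A : Module.End K V} (hA : IsDiagonalizableEnd A)
    {θ : Fin (d + 1) → K} (hW : IsEigenspaceOrdering A fun i => A.eigenspace (θ i)) :
    Function.Injective θ ∧ (∀ i, A.eigenspace (θ i) ≠ ⊥) ∧ ⨆ i, A.eigenspace (θ i) = ⊤ := by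
  refine ⟨fun i j hij => hW.1 (congrArg A.eigenspace hij), fun i => ?_, top_le_iff.1 ?_⟩
  · have hi : A.eigenspace (θ i) ∈ {U | IsEigenspaceOf A U} := hW.2 ▸ ⟨i, rfl⟩
    exact hi.1
  · rw [← hA]
    refine iSup_le fun c => ?_
    by_cases hc : A.eigenspace c = ⊥
    · rw [hc]; exact bot_le
    · obtain ⟨j, hj⟩ : A.eigenspace c ∈ Set.range fun i => A.eigenspace (θ i) := by
        rw [hW.2]; exact ⟨hc, c, rfl⟩
      rw [← hj]
      exact le_iSup (fun i => A.eigenspace (θ i)) j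

theorem exists_isEigenvalueSequence (Φ : TridiagonalSystem K V d) :
    ∃ θ θs, Φ.IsEigenvalueSequence θ ∧ Φ.IsDualEigenvalueSequence θs := by
  obtain ⟨W, hW, hE⟩ := Φ.standard
  obtain ⟨Ws, hWs, hEs⟩ := Φ.standard_star
  obtain ⟨θ, hθ⟩ := exists_eigenvalues hW.1
  obtain ⟨θs, hθs⟩ := exists_eigenvalues hWs.1
  exact ⟨θ, θs,
    fun i => (range_eq_of_arePrimitiveIdempotents Φ.isTridiagonalPair.diagonalizable
      hW.1 hE i).trans (hθ i),
    fun i => (range_eq_of_arePrimitiveIdempotents Φ.isTridiagonalPair.diagonalizable_star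
      hWs.1 hEs i).trans (hθs i)⟩

theorem tridiagonalData (Φ : TridiagonalSystem K V d) {θ θs : Fin (d + 1) → K}
    (hθ : Φ.IsEigenvalueSequence θ) (hθs : Φ.IsDualEigenvalueSequence θs) :
    TridiagonalData Φ.A Φ.Astar θ θs := by
  obtain ⟨W, hW, hE⟩ := Φ.standard
  obtain ⟨Ws, hWs, hEs⟩ := Φ.standard_star
  have hP := Φ.isTridiagonalPair
  obtain rfl : W = fun i => Φ.A.eigenspace (θ i) := funext fun i =>
    (range_eq_of_arePrimitiveIdempotents hP.diagonalizable hW.1 hE i).symm.trans (hθ i)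
  obtain rfl : Ws = fun i => Φ.Astar.eigenspace (θs i) := funext fun i =>
    (range_eq_of_arePrimitiveIdempotents hP.diagonalizable_star hWs.1 hEs i).symm.trans (hθs i)
  obtain ⟨h1, h2, h3⟩ := ordering_facts hP.diagonalizable hW.1
  obtain ⟨h4, h5, h6⟩ := ordering_facts hP.diagonalizable_star hWs.1
  refine ⟨h1, h4, h2, h5, h3, h6, hW.2, hWs.2, fun U hA hB => ?_⟩
  by_contra hU
  rw [not_or] at hU
  exact hP.irreducible ⟨U, hA, hB, hU.1, hU.2⟩

/-- The second factor of the intersection is the sum of all eigenspaces of A, hence V. -/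
theorem splitComponent_zero (Φ : TridiagonalSystem K V d) {θ θs : Fin (d + 1) → K}
    (hθ : Φ.IsEigenvalueSequence θ) (hθs : Φ.IsDualEigenvalueSequence θs) :
    Φ.splitComponent 0 = Φ.Astar.eigenspace (θs 0) := by
  have htop := (Φ.tridiagonalData hθ hθs).iSup_eq_top
  simp only [splitComponent, hθ _, hθs _, Fin.zero_le, iSup_pos, htop, inf_top_eq]
  simp

theorem eq_of_eigenspace_eq {A : Module.End K V} {a b : K} (ha : A.eigenspace a ≠ ⊥)
    (h : A.eigenspace a = A.eigenspace b) : a = b := by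
  obtain ⟨v, hv, hv0⟩ := Submodule.exists_mem_ne_zero_of_ne_bot ha
  have hv' := h ▸ hv
  rw [Module.End.mem_eigenspace_iff] at hv hv'
  exact smul_left_injective K hv0 (hv.symm.trans hv')

theorem raiseLower_apply (Φ : TridiagonalSystem K V d) (θ θs : Fin (d + 1) → K)
    (i : Fin (d + 1)) (v : V) : Φ.raiseLower θ θs i v =
      Polynomial.aeval Φ.Astar
        (∏ j ∈ Finset.univ.filter (fun j : Fin (d + 1) => 1 ≤ (j : ℕ) ∧ j ≤ i),
          (Polynomial.X - Polynomial.C (θs j))) (Polynomial.aeval Φ.A (tauPoly θ i) v) := rfl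

theorem exists_splitSequence [FiniteDimensional K V] (Φ : TridiagonalSystem K V d)
    (hΦ : Φ.IsSharp) {θ θs : Fin (d + 1) → K}
    (hθ : Φ.IsEigenvalueSequence θ) (hθs : Φ.IsDualEigenvalueSequence θs) :
    ∃ ζ : Fin (d + 1) → K, ∀ i, ∀ v ∈ Φ.splitComponent 0, Φ.raiseLower θ θs i v = ζ i • v := by
  have h := Φ.tridiagonalData hθ hθs
  rw [Φ.splitComponent_zero hθ hθs]
  obtain ⟨u, hu, hu0⟩ := Submodule.exists_mem_ne_zero_of_ne_bot (h.ne_bot_star 0)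
  have hle : Module.finrank K (Φ.Astar.eigenspace (θs 0)) ≤ 1 := by
    refine h.finrank_star_le.trans ?_
    rw [← hθ 0]
    exact hΦ.le
  have hspan : ∀ w ∈ Φ.Astar.eigenspace (θs 0), ∃ c : K, w = c • u := by
    intro w hw
    obtain ⟨x, hx⟩ := finrank_le_one_iff.1 hle
    obtain ⟨a, ha⟩ := hx ⟨u, hu⟩
    obtain ⟨b, hb⟩ := hx ⟨w, hw⟩
    have ha' : a • (x : V) = u := congrArg Subtype.val ha
    have hb' : b • (x : V) = w := congrArg Subtype.val hb
    have ha0 : a ≠ 0 := by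
      rintro rfl
      exact hu0 (by rw [← ha', zero_smul])
    exact ⟨b * a⁻¹, by rw [← ha', smul_smul, inv_mul_cancel_right₀ ha0, hb']⟩
  choose ζ hζ using fun i => hspan _ (h.aeval_raise_tauPoly_mem i hu)
  refine ⟨ζ, fun i v hv => ?_⟩
  obtain ⟨c, rfl⟩ := hspan v hv
  rw [map_smul, raiseLower_apply, hζ, smul_comm]

end TridiagonalSystem

/-! ### The parameter array and its properties -/

theorem mainTheorem2 {K V : Type*} [Field K] [AddCommGroup V] [Module K V]
    [FiniteDimensional K V] [Nontrivial V] {d : ℕ}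
    (Φ : TridiagonalSystem K V d) (hΦ : Φ.IsSharp) :
    -- the parameter array exists and is unique
    (∃! p : ScalarArray K d, Φ.HasParameterArray p) ∧
    ∀ p : ScalarArray K d, Φ.HasParameterArray p →
      -- (i)
      (∀ i j : Fin (d + 1), i ≠ j → p.θ i ≠ p.θ j ∧ p.θstar i ≠ p.θstar j) ∧
      -- (ii)
      (p.ζ 0 = 1 ∧ p.ζ (Fin.last d) ≠ 0 ∧
        ∑ i : Fin (d + 1), (etaPoly p.θ (d - (i : ℕ))).eval (p.θ 0) *
          (etaPoly p.θstar (d - (i : ℕ))).eval (p.θstar 0) * p.ζ i ≠ 0) ∧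
      -- (iii)
      (∃ c : K, ∀ (i : ℕ) (_ : 2 ≤ i) (_ : i + 1 ≤ d),
        (p.θ ⟨i - 2, by omega⟩ - p.θ ⟨i + 1, by omega⟩) /
            (p.θ ⟨i - 1, by omega⟩ - p.θ ⟨i, by omega⟩) = c ∧
        (p.θstar ⟨i - 2, by omega⟩ - p.θstar ⟨i + 1, by omega⟩) /
            (p.θstar ⟨i - 1, by omega⟩ - p.θstar ⟨i, by omega⟩) = c) := by
  refine ⟨?_, fun p hp => ?_⟩
  · obtain ⟨θ, θs, hθ, hθs⟩ := Φ.exists_isEigenvalueSequence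
    obtain ⟨ζ, hζ⟩ := Φ.exists_splitSequence hΦ hθ hθs
    have h := Φ.tridiagonalData hθ hθs
    refine ⟨⟨θ, θs, ζ⟩, ⟨hθ, hθs, hζ⟩, fun q hq => ?_⟩
    obtain ⟨qθ, qθs, qζ⟩ := q
    obtain rfl : θ = qθ := funext fun i =>
      TridiagonalSystem.eq_of_eigenspace_eq (h.ne_bot i) ((hθ i).symm.trans (hq.eigenvalue i))
    obtain rfl : θs = qθs := funext fun i =>
      TridiagonalSystem.eq_of_eigenspace_eq (h.ne_bot_star i)
        ((hθs i).symm.trans (hq.dualEigenvalue i))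
    obtain ⟨u, hu, hu0⟩ := Submodule.exists_mem_ne_zero_of_ne_bot (h.ne_bot_star 0)
    rw [← Φ.splitComponent_zero hθ hθs] at hu
    ext i
    · rfl
    · rfl
    · exact smul_left_injective K hu0 ((hq.split i u hu).symm.trans (hζ i u hu))
  · have h := Φ.tridiagonalData hp.eigenvalue hp.dualEigenvalue
    obtain ⟨u, hu, hu0⟩ := Submodule.exists_mem_ne_zero_of_ne_bot (h.ne_bot_star 0)
    have hζ : ∀ i, Φ.raiseLower p.θ p.θstar i u = p.ζ i • u := fun i =>
      hp.split i u (by rwa [Φ.splitComponent_zero hp.eigenvalue hp.dualEigenvalue])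
    refine ⟨fun i j hij => ⟨h.injective.ne hij, h.injective_star.ne hij⟩,
      ⟨?_, fun h0 => ?_, h.split_sum_ne_zero hu hu0 hζ⟩, ?_⟩
    · have h0 := hζ 0
      have hempty : (Finset.univ.filter fun j : Fin (d + 1) => 1 ≤ (j : ℕ) ∧ j ≤ 0) = ∅ := by
        ext j
        simp only [Finset.mem_filter_univ, Fin.le_def, Fin.val_zero, Finset.notMem_empty, iff_false]
        omega
      rw [TridiagonalSystem.raiseLower_apply, hempty] at h0
      simp only [Finset.prod_empty, map_one, Module.End.one_apply, tauPoly, Fin.val_zero,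
        Nat.not_lt_zero, Finset.filter_false] at h0
      exact smul_left_injective K hu0 (h0.symm.trans (one_smul K u).symm)
    · have h1 := hζ (Fin.last d)
      rw [h0, zero_smul, TridiagonalSystem.raiseLower_apply] at h1
      simp only [Fin.le_last, and_true] at h1
      exact hu0 (h.eq_zero_of_aeval_tauPoly hu
        (h.eq_zero_of_aeval_raise (h.aeval_tauPoly_mem u) h1))
    · by_cases hd : 3 ≤ d
      · obtain ⟨c, hc, hrec⟩ := h.exists_recurrence hd
        refine ⟨c⁻¹, fun i hi hid => ?_⟩
        obtain ⟨h1, h2⟩ := hrec ⟨i - 2, by omega⟩ ⟨i - 1, by omega⟩ ⟨i, by omega⟩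
          ⟨i + 1, by omega⟩ (by simp; omega) (by simp; omega) (by simp; omega)
        have hne : (⟨i - 1, by omega⟩ : Fin (d + 1)) ≠ ⟨i, by omega⟩ := by
          simp [Fin.ext_iff]; omega
        refine ⟨?_, ?_⟩
        · rw [div_eq_iff (sub_ne_zero.2 (h.injective.ne hne)), h1, inv_mul_cancel_left₀ hc]
        · rw [div_eq_iff (sub_ne_zero.2 (h.injective_star.ne hne)), h2, inv_mul_cancel_left₀ hc]
      -- For d < 3 no index i satisfies 2 ≤ i ≤ d - 1, so any constant serves.
      · exact ⟨0, fun i hi hid => absurd hid (by omega)⟩
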